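/- Let $q\ge 2$, $\Sigma=\{0,\dots,q-1\}$, and let $\mathcal F=\{a_1,\dots,a_s\}$ ($s\ge 1$, the $a_i$ distinct) be a finite collection of words over $\Sigma$, each of length at least $2$. Let $\Sigma_{\mathcal F}\subset\Sigma^{\mathbb N}$ be the set of one-sided sequences containing no $a_i$ as a block of consecutive symbols; a word is called allowed if it appears in some sequence of $\Sigma_{\mathcal F}$. Assume that $\mathcal F$ is minimal, i.e. every proper subword (block of consecutive symbols) of each $a_i$ is allowed. Let $p$ be the largest length of a word in $\mathcal F$, and let $A$ be the $(0,1)$ matrix indexed by the allowed words of length $p-1$ with $A_{xy}=1$ if and only if $x_2\cdots x_{p-1}=y_1\cdots y_{p-2}$ and $x_1\cdots x_{p-1}y_{p-1}$ is allowed. Assume that $A$ is irreducible (for all $x,y$ there is $\ell\ge 1$ with $(A^\ell)_{xy}>0$), and let $\theta$ be its Perron root, that is, its spectral radius. For words $x,y$ with $|x|=m$, define the correlation polynomial $(x,y)_z=\sum_{\ell=0}^{m-1}b_\ell z^{m-1-\ell}$, where $b_\ell=1$ if the overlapping parts of $x$ and $y$ are identical when the first symbol of $y$ is placed below the $(\ell+1)$-th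 symbol of $x$, and $b_\ell=0$ otherwise. Let $M(z)=\big((a_j,a_i)_z\big)_{1\le i,j\le s}$, let $\mathcal R_i(z)$ and $\mathcal C_j(z)$ be the sum of the $i$-th row and of the $j$-th column of $M(z)^{-1}$, and let $\widetilde{a_i}$ be $a_i$ with its first symbol removed. Then the limits $\mathcal R_i(\theta):=\lim_{z\to\theta}\mathcal R_i(z)$ and $\mathcal C_j(\theta):=\lim_{z\to\theta}\mathcal C_j(z)$ (over complex $z\ne\theta$) exist and are real for all $i,j$, and the vectors $u=(u_x)_x$, $v=(v_x)_x$, indexed by the allowed words $x$ of length $p-1$ and given by $$u_x=1-\sum_{i=1}^s\mathcal R_i(\theta)\,(\widetilde{a_i},x)_\theta,\qquad v_x=1-\sum_{j=1}^s\mathcal C_j(\theta)\,(x,a_j)_\theta,$$ are respectively a left and a right eigenvector of $A$ for the eigenvalue $\theta$: $u\ne 0$, $v\ne 0$, $u^{T}A=\theta u^{T}$ and $Av=\theta v$. -/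

import Mathlib

open scoped Polynomial Topology

namespace SFT

variable {q s : ℕ}

/-- The finite word `w` appears as a block of consecutive symbols in the one-sided sequence `ω`. -/
def Occurs (w : List (Fin q)) (ω : ℕ → Fin q) : Prop :=
  ∃ n : ℕ, ∀ k (hk : k < w.length), ω (n + k) = w[k]

/-- The subshift of all one-sided sequences over `{0, …, q - 1}` that contain none of the
words `a i`. -/
def subshift (a : Fin s → List (Fin q)) : Set (ℕ → Fin q) :=
  {ω | ∀ i, ¬ Occurs (a i) ω}

/-- A word is allowed if it appears in some sequence of the subshift. -/
def Allowed (a : Fin s → List (Fin q)) (w : List (Fin q)) : Prop :=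
  ∃ ω ∈ subshift a, Occurs w ω

/-- A collection of forbidden words is minimal if every proper subword (block of consecutive
symbols) of a forbidden word is allowed. -/
def IsMinimal (a : Fin s → List (Fin q)) : Prop :=
  ∀ i, ∀ w : List (Fin q), w <:+: a i → w ≠ a i → Allowed a w

/-- The length `p` of the longest forbidden word. -/
def maxLength (a : Fin s → List (Fin q)) : ℕ :=
  Finset.univ.sup fun i => (a i).length

/-- The allowed words of length `p - 1`. -/
abbrev AllowedWord (a : Fin s → List (Fin q)) : Type :=
  {x : List (Fin q) // x.length = maxLength a - 1 ∧ Allowed a x}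

instance (a : Fin s → List (Fin q)) : Finite (AllowedWord a) :=
  ((List.finite_length_eq (Fin q) (maxLength a - 1)).subset fun _ h => h.1).to_subtype

noncomputable instance (a : Fin s → List (Fin q)) : Fintype (AllowedWord a) :=
  Fintype.ofFinite _

open Classical in
/-- The adjacency matrix: the entry at `(x₁ … x_{p-1}, y₁ … y_{p-1})` is `1` if
`y₁ … y_{p-2} = x₂ … x_{p-1}` and the word `x₁ … x_{p-1} y_{p-1}` is allowed, and `0` otherwise.
The symbol `b` below is the last symbol of `y`. -/
noncomputable def adjMatrix (a : Fin s → List (Fin q)) :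
    Matrix (AllowedWord a) (AllowedWord a) ℝ :=
  Matrix.of fun x y =>
    if ∃ b : Fin q, y.1 = x.1.tail ++ [b] ∧ Allowed a (x.1 ++ [b]) then 1 else 0

/-- The Perron root of the subshift: the spectral radius of its adjacency matrix, that is, the
largest modulus of a complex eigenvalue. -/
noncomputable def perronRoot (a : Fin s → List (Fin q)) : ℝ :=
  (spectralRadius ℂ ((adjMatrix a).map (algebraMap ℝ ℂ))).toReal

/-- When the first symbol of `y` is placed below the symbol of `x` with (zero-based) index `l`,
the overlapping parts of `x` and `y` are identical. -/
abbrev OverlapAt (x y : List (Fin q)) (l : ℕ) : Prop :=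
  ∀ k < min (x.length - l) y.length, x[l + k]? = y[k]?

/-- The correlation polynomial `(x, y)_z`. -/
noncomputable def corr (x y : List (Fin q)) : ℤ[X] :=
  ∑ l ∈ Finset.range x.length,
    if OverlapAt x y l then Polynomial.X ^ (x.length - 1 - l) else 0

/-- The correlation matrix `M(z)` at a complex number `z`; its `(i, j)` entry is
`(a j, a i)_z`. -/
noncomputable def corrMatrix (a : Fin s → List (Fin q)) (z : ℂ) : Matrix (Fin s) (Fin s) ℂ :=
  Matrix.of fun i j => Polynomial.aeval z (corr (a j) (a i))

/-- The sum of the `i`-th row of `M(z)⁻¹`. -/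
noncomputable def rowSum (a : Fin s → List (Fin q)) (i : Fin s) (z : ℂ) : ℂ :=
  ∑ j, (corrMatrix a z)⁻¹ i j

/-- The sum of the `j`-th column of `M(z)⁻¹`. -/
noncomputable def colSum (a : Fin s → List (Fin q)) (j : Fin s) (z : ℂ) : ℂ :=
  ∑ i, (corrMatrix a z)⁻¹ i j

/-- The vector `u_x = 1 - ∑ i, R i * (ã i, x)_θ`, where `ã i` is `a i` without its first
symbol. -/
noncomputable def leftVec (a : Fin s → List (Fin q)) (R : Fin s → ℝ) (x : AllowedWord a) : ℝ :=
  1 - ∑ i, R i * Polynomial.aeval (perronRoot a) (corr (a i).tail x.1)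

/-- The vector `v_x = 1 - ∑ j, C j * (x, a j)_θ`. -/
noncomputable def rightVec (a : Fin s → List (Fin q)) (C : Fin s → ℝ) (x : AllowedWord a) : ℝ :=
  1 - ∑ j, C j * Polynomial.aeval (perronRoot a) (corr x.1 (a j))

end SFT

/-! Give a word `x` the weight W(x) = κ - ∑ yᵢ (aᵢ, x)_t. If `x` contains no forbidden word, every
overlap of `x` with `aᵢ` extends to the left by exactly one letter, so ∑_c W(cx) = t W(x) + δ with δ
= (q - t)κ - ∑ yᵢ (`sum_wordWeight_cons`). If M(t)y = κ·1, then W vanishes on every aⱼ, hence on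
every forbidden cx, and only the allowed extensions contribute. Since W ignores the last letter of
an allowed word of length p, this says that W on words of length p - 1 solves WᵀA = tWᵀ + δ·1ᵀ.

At t = θ, pairing with the positive Perron vector gives δ = 0, and W has constant sign
(`Matrix.IsIrreducible.eigenvector_sign`). For κ = 0 the recursion, used down to the empty word and
back up, forces W = 0 and then y = 0. So M(θ) is invertible, and the limits are simply row and
column sums of M(θ)⁻¹. For κ = 1 the same descent shows W ≠ 0, because W is 1 at the empty word.
This is `u`; reversing all words transposes M and gives `v`. -/

namespace Matrix

open Filter Topology

/-! ### Perron–Frobenius theory for irreducible matrices -/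

section Perron

variable {n : Type*} [Fintype n] {A : Matrix n n ℝ}

theorem mulVec_pos_of_pos {P : Matrix n n ℝ} (hP : ∀ i j, 0 < P i j) {x : n → ℝ}
    (hx : ∀ i, 0 ≤ x i) (hx0 : x ≠ 0) (i : n) : 0 < (P *ᵥ x) i := by
  obtain ⟨j, hj⟩ := Function.ne_iff.1 hx0
  refine Finset.sum_pos' (fun k _ => mul_nonneg (hP i k).le (hx k)) ⟨j, Finset.mem_univ j, ?_⟩
  exact mul_pos (hP i j) (lt_of_le_of_ne (hx j) (Ne.symm hj))

theorem mulVec_mono_of_nonneg (hA : ∀ i j, 0 ≤ A i j) {x y : n → ℝ} (h : ∀ i, x i ≤ y i) (i : n) :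
    (A *ᵥ x) i ≤ (A *ᵥ y) i :=
  Finset.sum_le_sum fun j _ => mul_le_mul_of_nonneg_left (h j) (hA i j)

variable [DecidableEq n]

/-- An irreducible matrix commutes with an entrywise positive matrix. -/
theorem IsIrreducible.exists_commute_pos (hA : A.IsIrreducible) :
    ∃ P : Matrix n n ℝ, Commute P A ∧ ∀ i j, 0 < P i j := by
  have h := (isIrreducible_iff_exists_pow_pos hA.nonneg).1 hA
  choose k _ hk using h
  refine ⟨∑ i, ∑ j, A ^ k i j, ?_, fun i j => ?_⟩
  · exact Commute.sum_left _ _ _ fun i _ => Commute.sum_left _ _ _ fun j _ =>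
      (Commute.refl A).pow_left _
  · simp only [Matrix.sum_apply]
    refine (hk i j).trans_le ?_
    refine (Finset.single_le_sum (f := fun j' => (A ^ k i j') i j)
      (fun j' _ => pow_apply_nonneg hA.nonneg _ i j) (Finset.mem_univ j)).trans ?_
    exact Finset.single_le_sum (f := fun i' => ∑ j', (A ^ k i' j') i j)
      (fun i' _ => Finset.sum_nonneg fun j' _ => pow_apply_nonneg hA.nonneg _ i j)
      (Finset.mem_univ i)

/-- A nonnegative nonzero eigenvector of an irreducible matrix is positive. -/
theorem IsIrreducible.pos_of_mulVec_eq (hA : A.IsIrreducible) {ρ : ℝ} {x : n → ℝ}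
    (hx : ∀ i, 0 ≤ x i) (hx0 : x ≠ 0) (h : A *ᵥ x = ρ • x) (i : n) : 0 < x i := by
  have h' := (isIrreducible_iff_exists_pow_pos hA.nonneg).1 hA
  obtain ⟨j, hj⟩ := Function.ne_iff.1 hx0
  obtain ⟨k, -, hk⟩ := h' i j
  have hpow : (A ^ k) *ᵥ x = ρ ^ k • x := by
    clear hk
    induction k with
    | zero => simp
    | succ k ih => rw [pow_succ, ← mulVec_mulVec, h, mulVec_smul, ih, smul_smul, pow_succ, mul_comm]
  have h1 : 0 < ((A ^ k) *ᵥ x) i :=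
    Finset.sum_pos' (fun l _ => mul_nonneg (pow_apply_nonneg hA.nonneg _ i l) (hx l))
      ⟨j, Finset.mem_univ j, mul_pos hk (lt_of_le_of_ne (hx j) (Ne.symm hj))⟩
  refine lt_of_le_of_ne (hx i) fun h0 => ?_
  rw [hpow, Pi.smul_apply, ← h0, smul_zero] at h1
  exact h1.false

attribute [local instance] Matrix.linftyOpNormedRing Matrix.linftyOpNormedAlgebra

/-- A positive vector `x` with `A x ≥ c x` bounds the spectral radius from below by `c`. -/
theorem le_spectralRadius_of_le_mulVec [Nonempty n] (hA : ∀ i j, 0 ≤ A i j) {c : ℝ} (hc : 0 ≤ c)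
    {x : n → ℝ} (hx : ∀ i, 0 < x i) (h : ∀ i, c * x i ≤ (A *ᵥ x) i) :
    ENNReal.ofReal c ≤ spectralRadius ℂ (A.map (algebraMap ℝ ℂ)) := by
  have hpow : ∀ k : ℕ, ∀ i, c ^ k * x i ≤ ((A ^ k) *ᵥ x) i := by
    intro k
    induction k with
    | zero => simp
    | succ k ih =>
      intro i
      rw [pow_succ', pow_succ', ← mulVec_mulVec]
      calc c * c ^ k * x i = c ^ k * (c * x i) := by ring
        _ ≤ c ^ k * (A *ᵥ x) i := by gcongr; exact h i
        _ = (A *ᵥ (c ^ k • x)) i := by rw [mulVec_smul]; rfl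
        _ ≤ _ := mulVec_mono_of_nonneg hA ih i
  set B := A.map (algebraMap ℝ ℂ) with hB
  -- Compare sup norms at a coordinate where `x` is largest; Gelfand's formula then turns these
  -- bounds into one on the spectral radius.
  have hnorm : ∀ k : ℕ, c ^ k ≤ ‖B ^ k‖ := by
    intro k
    set y : n → ℂ := fun i => (x i : ℂ) with hy
    obtain ⟨i, hi⟩ : ∃ i, ‖y i‖ = ‖y‖ := by
      obtain ⟨i, -, hi⟩ := Finset.exists_max_image Finset.univ (fun i => ‖y i‖)
        Finset.univ_nonempty
      exact ⟨i, le_antisymm (norm_le_pi_norm y i)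
        ((pi_norm_le_iff_of_nonneg (norm_nonneg _)).2 fun j => hi j (Finset.mem_univ j))⟩
    have hxi : ‖y i‖ = x i := by simp [hy, abs_of_pos (hx i)]
    have hBk : (B ^ k *ᵥ y) i = (((A ^ k) *ᵥ x) i : ℝ) := by
      have : B ^ k = (A ^ k).map (algebraMap ℝ ℂ) := by
        rw [hB, ← RingHom.mapMatrix_apply, ← RingHom.mapMatrix_apply, map_pow]
      rw [this]
      simp [mulVec, dotProduct, hy]
    have h1 : ‖(B ^ k *ᵥ y) i‖ ≤ ‖B ^ k‖ * ‖y‖ :=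
      (norm_le_pi_norm _ i).trans (linfty_opNorm_mulVec _ _)
    have h2 : c ^ k * x i ≤ ‖B ^ k‖ * x i := by
      calc c ^ k * x i ≤ ((A ^ k) *ᵥ x) i := hpow k i
        _ ≤ ‖(B ^ k *ᵥ y) i‖ := by rw [hBk, Complex.norm_real]; exact le_abs_self _
        _ ≤ ‖B ^ k‖ * x i := by rw [← hxi, hi]; exact h1
    exact le_of_mul_le_mul_right h2 (hx i)
  refine ge_of_tendsto (spectrum.pow_norm_pow_one_div_tendsto_nhds_spectralRadius B) ?_
  filter_upwards [eventually_gt_atTop 0] with k hk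
  refine ENNReal.ofReal_le_ofReal ?_
  calc c = (c ^ k) ^ (1 / k : ℝ) := by
        rw [one_div, Real.pow_rpow_inv_natCast hc hk.ne']
    _ ≤ _ := Real.rpow_le_rpow (pow_nonneg hc k) (hnorm k) (by positivity)

/-- **Perron–Frobenius**: the spectral radius of an irreducible matrix is an eigenvalue with a
positive eigenvector. -/
theorem IsIrreducible.exists_pos_eigenvector [Nonempty n] (hA : A.IsIrreducible) :
    ∃ r : n → ℝ, (∀ i, 0 < r i) ∧
      A *ᵥ r = (spectralRadius ℂ (A.map (algebraMap ℝ ℂ))).toReal • r := by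
  set B := A.map (algebraMap ℝ ℂ) with hB
  obtain ⟨μ, hμ, hμr⟩ := spectrum.exists_nnnorm_eq_spectralRadius B
  set ρ := (spectralRadius ℂ B).toReal with hρ
  have hρμ : ρ = ‖μ‖ := by rw [hρ, ← hμr]; simp
  have hρtop : ENNReal.ofReal ρ = spectralRadius ℂ B := by
    rw [hρ, ENNReal.ofReal_toReal]; rw [← hμr]; simp
  rw [← spectrum_toLin', ← Module.End.hasEigenvalue_iff_mem_spectrum] at hμ
  obtain ⟨y, hy⟩ := hμ.exists_hasEigenvector
  have hy1 : B *ᵥ y = μ • y := by simpa using hy.apply_eq_smul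
  have hy0 : y ≠ 0 := hy.2
  set x : n → ℝ := fun i => ‖y i‖ with hx
  have hx0 : x ≠ 0 := by
    intro h
    exact hy0 (funext fun i => norm_eq_zero.1 (congrFun h i))
  have hle : ∀ i, ρ * x i ≤ (A *ᵥ x) i := by
    intro i
    have h1 : ‖(B *ᵥ y) i‖ = ρ * x i := by rw [hy1, Pi.smul_apply, smul_eq_mul, norm_mul, hρμ]
    rw [← h1]
    refine (norm_sum_le _ _).trans_eq (Finset.sum_congr rfl fun j _ => ?_)
    simp [hB, hx, abs_of_nonneg (hA.nonneg i j)]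
  -- Otherwise a positive matrix `P` commuting with `A` makes the inequality for `P *ᵥ x` strict in
  -- every coordinate, so a constant `c > ρ` would bound the spectral radius from below.
  have heq : A *ᵥ x = ρ • x := by
    by_contra hne
    obtain ⟨P, hPA, hP⟩ := hA.exists_commute_pos
    have hz : ∀ i, 0 < (P *ᵥ (A *ᵥ x - ρ • x)) i :=
      mulVec_pos_of_pos hP (fun i => sub_nonneg.2 (hle i)) (sub_ne_zero.2 hne)
    have hx' : ∀ i, 0 < (P *ᵥ x) i := mulVec_pos_of_pos hP (fun i => norm_nonneg _) hx0
    have hz' : P *ᵥ (A *ᵥ x - ρ • x) = A *ᵥ (P *ᵥ x) - ρ • (P *ᵥ x) := by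
      rw [mulVec_sub, mulVec_mulVec, mulVec_mulVec, hPA.eq, mulVec_smul]
    rw [hz'] at hz
    obtain ⟨i₀, -, hi₀⟩ := Finset.exists_min_image Finset.univ
      (fun i => (A *ᵥ (P *ᵥ x)) i / (P *ᵥ x) i) Finset.univ_nonempty
    set c := (A *ᵥ (P *ᵥ x)) i₀ / (P *ᵥ x) i₀ with hc
    have hρc : ρ < c := by
      rw [hc, lt_div_iff₀ (hx' i₀)]
      have := hz i₀
      simpa using this
    have hρ0 : 0 ≤ ρ := ENNReal.toReal_nonneg
    have h1 := le_spectralRadius_of_le_mulVec hA.nonneg (hρ0.trans hρc.le) hx' fun i => by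
      rw [← le_div_iff₀ (hx' i)]
      exact hi₀ i (Finset.mem_univ i)
    rw [← hB, ← hρtop, ENNReal.ofReal_le_ofReal_iff hρ0] at h1
    exact absurd hρc h1.not_gt
  exact ⟨x, hA.pos_of_mulVec_eq (fun i => norm_nonneg _) hx0 heq, heq⟩

theorem spectralRadius_transpose (B : Matrix n n ℂ) :
    spectralRadius ℂ Bᵀ = spectralRadius ℂ B := by
  have : spectrum ℂ Bᵀ = spectrum ℂ B := by
    ext z
    rw [spectrum.mem_iff, spectrum.mem_iff, ← isUnit_transpose, transpose_sub, transpose_transpose]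
    simp [algebraMap_eq_diagonal]
  simp only [spectralRadius, this]

theorem IsIrreducible.spectralRadius_pos [Nonempty n] (hA : A.IsIrreducible) :
    0 < (spectralRadius ℂ (A.map (algebraMap ℝ ℂ))).toReal := by
  obtain ⟨r, hr, h⟩ := hA.exists_pos_eigenvector
  set ρ := (spectralRadius ℂ (A.map (algebraMap ℝ ℂ))).toReal
  refine lt_of_le_of_ne ENNReal.toReal_nonneg fun h0 => ?_
  obtain ⟨i⟩ := ‹Nonempty n›
  obtain ⟨k, hk0, hk⟩ := (isIrreducible_iff_exists_pow_pos hA.nonneg).1 hA i i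
  have h1 : A ^ k *ᵥ r = 0 := by
    obtain ⟨m, rfl⟩ := Nat.exists_eq_succ_of_ne_zero hk0.ne'
    rw [Nat.succ_eq_add_one, pow_succ, ← mulVec_mulVec, h, ← h0, zero_smul, mulVec_zero]
  have h2 : 0 < (A ^ k *ᵥ r) i :=
    Finset.sum_pos' (fun l _ => mul_nonneg (pow_apply_nonneg hA.nonneg _ i l) (hr l).le)
      ⟨i, Finset.mem_univ i, mul_pos hk (hr i)⟩
  rw [h1] at h2
  exact h2.false

/-- A real solution of `A x = ρ x + δ`, with `ρ` the spectral radius of the irreducible matrix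
`A`, has `δ = 0` and constant sign. -/
theorem IsIrreducible.eigenvector_sign [Nonempty n] (hA : A.IsIrreducible) {x : n → ℝ} {δ : ℝ}
    (h : ∀ i, (A *ᵥ x) i = (spectralRadius ℂ (A.map (algebraMap ℝ ℂ))).toReal * x i + δ) :
    δ = 0 ∧ ((∀ i, x i = 0) ∨ (∀ i, 0 < x i) ∨ (∀ i, x i < 0)) := by
  obtain ⟨l, hl, hlA⟩ := hA.transpose.exists_pos_eigenvector
  rw [transpose_map, spectralRadius_transpose, mulVec_transpose] at hlA
  set ρ := (spectralRadius ℂ (A.map (algebraMap ℝ ℂ))).toReal with hρ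
  have pair : ∀ y : n → ℝ, l ⬝ᵥ (A *ᵥ y) = ρ * (l ⬝ᵥ y) := fun y => by
    rw [dotProduct_mulVec, hlA, smul_dotProduct, smul_eq_mul]
  have hδ : δ = 0 := by
    have h1 : l ⬝ᵥ (A *ᵥ x) = ρ * (l ⬝ᵥ x) + δ * ∑ i, l i := by
      simp only [dotProduct, h, Finset.mul_sum, ← Finset.sum_add_distrib]
      exact Finset.sum_congr rfl fun i _ => by ring
    have h2 : 0 < ∑ i, l i := Finset.sum_pos (fun i _ => hl i) Finset.univ_nonempty
    have h3 : δ * ∑ i, l i = 0 := by linarith [pair x]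
    exact (mul_eq_zero.1 h3).resolve_right h2.ne'
  refine ⟨hδ, ?_⟩
  have hAx : A *ᵥ x = ρ • x := funext fun i => by rw [h i, hδ, add_zero]; rfl
  -- The triangle inequality gives `A |x| ≥ ρ |x|`, and pairing with `l > 0` forces equality. Then
  -- `|x| + x` is a nonnegative eigenvector, so it is zero or everywhere positive.
  set y : n → ℝ := fun i => |x i| with hy
  have hρ0 : 0 ≤ ρ := ENNReal.toReal_nonneg
  have hle : ∀ i, ρ * y i ≤ (A *ᵥ y) i := fun i => by
    have h1 : |(A *ᵥ x) i| = ρ * y i := by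
      rw [hAx, Pi.smul_apply, smul_eq_mul, abs_mul, abs_of_nonneg hρ0]
    rw [← h1]
    refine (Finset.abs_sum_le_sum_abs _ _).trans_eq (Finset.sum_congr rfl fun j _ => ?_)
    rw [abs_mul, abs_of_nonneg (hA.nonneg i j)]
  have hAy : A *ᵥ y = ρ • y := by
    have h1 : ∑ i, l i * ((A *ᵥ y) i - ρ * y i) = 0 := by
      have := pair y
      simp only [dotProduct, Finset.mul_sum] at this
      rw [← sub_eq_zero, ← Finset.sum_sub_distrib] at this
      rw [← this]
      exact Finset.sum_congr rfl fun i _ => by ring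
    rw [Finset.sum_eq_zero_iff_of_nonneg fun i _ =>
      mul_nonneg (hl i).le (sub_nonneg.2 (hle i))] at h1
    funext i
    have h2 := (mul_eq_zero.1 (h1 i (Finset.mem_univ i))).resolve_left (hl i).ne'
    exact sub_eq_zero.1 h2
  by_cases hp : y + x = 0
  · by_cases hy0 : y = 0
    · exact Or.inl fun i => abs_eq_zero.1 (congrFun hy0 i)
    · refine Or.inr (Or.inr fun i => ?_)
      have h1 := hA.pos_of_mulVec_eq (fun i => abs_nonneg _) hy0 hAy i
      have h2 := congrFun hp i
      simp only [Pi.add_apply, Pi.zero_apply] at h2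
      linarith
  · refine Or.inr (Or.inl fun i => ?_)
    have h1 := hA.pos_of_mulVec_eq (x := y + x) (fun i => by
      have := neg_abs_le (x i)
      simp only [Pi.add_apply, hy]; linarith) hp (by rw [mulVec_add, hAy, hAx, smul_add]) i
    by_contra h2
    simp only [Pi.add_apply, hy, abs_of_nonpos (not_lt.1 h2)] at h1
    linarith

end Perron

end Matrix

namespace SFT

/-! ### Allowed words are the words avoiding the forbidden ones -/

section Words

variable {q s : ℕ}

/-- The word `w` contains none of the words `a i`. -/
def Avoids (a : Fin s → List (Fin q)) (w : List (Fin q)) : Prop :=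
  ∀ i, ¬ a i <:+: w

theorem Avoids.mono {a : Fin s → List (Fin q)} {v w : List (Fin q)} (hw : Avoids a w)
    (h : v <:+: w) : Avoids a v :=
  fun i hi => hw i (hi.trans h)

theorem Allowed.avoids {a : Fin s → List (Fin q)} {w : List (Fin q)} (hw : Allowed a w) :
    Avoids a w := by
  obtain ⟨ω, hω, n, hn⟩ := hw
  rintro i ⟨u, v, rfl⟩
  refine hω i ⟨n + u.length, fun k hk => ?_⟩
  have := hn (u.length + k) (by simp; omega)
  rw [add_assoc, this]
  simp [hk]

theorem IsMinimal.eq_of_infix {a : Fin s → List (Fin q)} (hmin : IsMinimal a)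
    (ha : Function.Injective a) {i j : Fin s} (h : a i <:+: a j) : i = j := by
  by_contra hij
  exact (hmin j (a i) h fun e => hij (ha e)).avoids i List.infix_rfl

/-- If every extension `w c` ended in a forbidden word, take the longest such word and delete its
last letter. The remainder `v` is allowed, so some `v d` avoids `a`. But the forbidden suffix of `w
d` is no longer than `v d`, hence lies inside it. -/
theorem IsMinimal.exists_avoids_append {a : Fin s → List (Fin q)} (hmin : IsMinimal a)
    (hq : 0 < q) (hne : ∀ i, a i ≠ []) {w : List (Fin q)} (hw : Avoids a w) :
    ∃ c, Avoids a (w ++ [c]) := by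
  by_contra! hcon
  have hsuf : ∀ c, ∃ i, a i <:+ w ++ [c] := fun c => by
    have := hcon c
    simp only [Avoids, not_forall, not_not] at this
    obtain ⟨i, hi⟩ := this
    exact ⟨i, (List.infix_concat_iff.1 hi).resolve_right (hw i)⟩
  choose f hf using hsuf
  have : Nonempty (Fin q) := ⟨⟨0, hq⟩⟩
  obtain ⟨c, -, hc⟩ := Finset.exists_max_image Finset.univ (fun c => (a (f c)).length)
    Finset.univ_nonempty
  have hlen := List.length_pos_iff.2 (hne (f c))
  obtain ⟨ω, hω, n, hn⟩ := hmin (f c) (a (f c)).dropLast (List.dropLast_prefix _).isInfix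
    (fun h => by have := congrArg List.length h; simp at this; omega)
  set v := (a (f c)).dropLast with hv
  have hvl : v.length + 1 = (a (f c)).length := by rw [hv, List.length_dropLast]; omega
  set d := ω (n + v.length) with hd
  have hvd : Avoids a (v ++ [d]) := by
    refine Allowed.avoids ⟨ω, hω, n, fun k hk => ?_⟩
    rw [List.getElem_append]
    split_ifs with h
    · exact hn k h
    · have : k = v.length := by simp at hk; omega
      simp [this, hd]
  refine hvd (f d) (List.IsSuffix.isInfix ?_)
  have hvw : v ++ [d] <:+ w ++ [d] := by
    obtain ⟨t, ht⟩ := hf c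
    have e : a (f c) = v ++ [(a (f c)).getLast (hne _)] := (List.dropLast_append_getLast _).symm
    rw [e, ← List.append_assoc] at ht
    exact ⟨t, by rw [← List.append_assoc, (List.append_inj' ht rfl).1]⟩
  refine List.suffix_of_suffix_length_le (hf d) hvw ?_
  have := hc d (Finset.mem_univ d)
  simp only [List.length_append, List.length_singleton, hvl]
  exact this

theorem IsMinimal.allowed_of_avoids {a : Fin s → List (Fin q)} (hmin : IsMinimal a)
    (hq : 0 < q) (hne : ∀ i, a i ≠ []) {w : List (Fin q)} (hw : Avoids a w) : Allowed a w := by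
  choose f hf using fun v : {v // Avoids a v} => hmin.exists_avoids_append hq hne v.2
  let g : {v // Avoids a v} → {v // Avoids a v} := fun v => ⟨v.1 ++ [f v], hf v⟩
  let W : ℕ → List (Fin q) := fun n => (g^[n] ⟨w, hw⟩).1
  have hWa : ∀ n, Avoids a (W n) := fun n => (g^[n] ⟨w, hw⟩).2
  have hWs : ∀ n, W (n + 1) = W n ++ [f (g^[n] ⟨w, hw⟩)] := fun n => by
    simp only [W, Function.iterate_succ_apply', g]
  have hWl : ∀ n, (W n).length = w.length + n := fun n => by
    induction n with
    | zero => rfl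
    | succ n ih => rw [hWs, List.length_append, ih]; rfl
  have hWp : ∀ m n, m ≤ n → W m <+: W n := fun m n h => by
    induction n, h using Nat.le_induction with
    | base => exact List.prefix_rfl
    | succ n _ ih => exact ih.trans (by rw [hWs]; exact List.prefix_append _ _)
  have hk0 : ∀ k, k < (W (k + 1)).length := fun k => by rw [hWl]; omega
  let ω : ℕ → Fin q := fun k => (W (k + 1))[k]'(hk0 k)
  have hω : ∀ k n (h : k < (W n).length), ω k = (W n)[k] := fun k n h => by
    rcases le_total (k + 1) n with h' | h'
    · exact (hWp _ _ h').getElem _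
    · exact ((hWp _ _ h').getElem _).symm
  refine ⟨ω, fun i => ?_, 0, fun k hk => ?_⟩
  · rintro ⟨n, hn⟩
    refine hWa (n + (a i).length) i ?_
    have : a i = ((W (n + (a i).length)).drop n).take (a i).length := by
      refine List.ext_getElem (by simp [hWl]; omega) fun k h1 h2 => ?_
      rw [← hn k h1, List.getElem_take, List.getElem_drop]
      exact hω _ _ _
    rw [this]
    exact (List.take_prefix _ _).isInfix.trans (by
      rw [← this]; exact (List.drop_suffix _ _).isInfix)
  · rw [zero_add]
    exact hω k 0 hk

theorem IsMinimal.allowed_iff {a : Fin s → List (Fin q)} (hmin : IsMinimal a)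
    (hq : 0 < q) (hne : ∀ i, a i ≠ []) {w : List (Fin q)} : Allowed a w ↔ Avoids a w :=
  ⟨Allowed.avoids, hmin.allowed_of_avoids hq hne⟩

end Words

/-! ### Overlaps of words and correlation polynomials -/

section Overlap

variable {q s : ℕ}

/-- The sum of `t ^ k` over the lengths `k + 1` of the nonempty words that are both a suffix of `x`
and a prefix of `y`. -/
def overlap {R : Type*} [CommRing R] (t : R) (x y : List (Fin q)) : R :=
  ∑ k ∈ Finset.range y.length, if y.take (k + 1) <:+ x then t ^ k else 0

theorem overlap_eq_sum {R : Type*} [CommRing R] (t : R) (x y : List (Fin q)) {N : ℕ}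
    (hN : y.length ≤ N) :
    overlap t x y =
      ∑ k ∈ Finset.range N, if k < y.length ∧ y.take (k + 1) <:+ x then t ^ k else 0 := by
  rw [overlap, ← Finset.sum_subset (Finset.range_mono hN)]
  · refine Finset.sum_congr rfl fun k hk => ?_
    simp [Finset.mem_range.1 hk]
  · intro k _ hk
    rw [if_neg]
    simpa using fun h => absurd h (by simpa using hk)

theorem take_suffix_reverse {x y : List (Fin q)} {k : ℕ} (hk : k ≤ y.length)
    (h : y.take k <:+ x) : k ≤ x.length ∧ x.reverse.take k <:+ y.reverse := by
  have hl : k ≤ x.length := by simpa [hk] using h.length_le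
  refine ⟨hl, ?_⟩
  have h1 : (y.take k).reverse <+: x.reverse := List.reverse_prefix.2 h
  have h2 := List.prefix_iff_eq_take.1 h1
  rw [List.length_reverse, List.length_take, min_eq_left hk] at h2
  rw [← h2]
  exact List.reverse_suffix.2 (List.take_prefix _ _)

theorem overlap_reverse {R : Type*} [CommRing R] (t : R) (x y : List (Fin q)) :
    overlap t y.reverse x.reverse = overlap t x y := by
  rw [overlap_eq_sum t x y (N := x.length + y.length) (by omega),
    overlap_eq_sum t y.reverse x.reverse (N := x.length + y.length) (by simp)]
  refine Finset.sum_congr rfl fun k _ => ?_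
  refine if_congr ⟨fun ⟨h1, h2⟩ => ?_, fun ⟨h1, h2⟩ => ?_⟩ rfl rfl
  · have := take_suffix_reverse h1 h2
    simp only [List.reverse_reverse, List.length_reverse] at this
    exact ⟨this.1, this.2⟩
  · have := take_suffix_reverse h1 h2
    exact ⟨by simpa using this.1, this.2⟩

theorem overlap_nil {R : Type*} [CommRing R] (t : R) (x : List (Fin q)) :
    overlap t x [] = 0 := by
  simp [overlap]

theorem overlap_append_singleton {R : Type*} [CommRing R] (t : R) (x y : List (Fin q))
    (c : Fin q) :
    overlap t x (y ++ [c]) =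
      overlap t x y + if y ++ [c] <:+ x then t ^ y.length else 0 := by
  rw [overlap, List.length_append, List.length_singleton, Finset.sum_range_succ]
  congr 1
  · refine Finset.sum_congr rfl fun k hk => ?_
    rw [List.take_append_of_le_length (by simpa using hk)]
  · rw [List.take_of_length_le (by simp)]

theorem sum_cons_suffix {R : Type*} [CommRing R] {x w : List (Fin q)} (h : w ≠ x) (t : R) :
    ∑ c : Fin q, (if c :: w <:+ x then t else 0) = if w <:+ x then t else 0 := by
  split_ifs with hw
  · obtain ⟨u, rfl⟩ := hw
    have hu : u ≠ [] := by rintro rfl; exact h rfl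
    have key : ∀ c, c :: w <:+ u ++ w ↔ c = u.getLast hu := fun c => by
      constructor
      · rintro ⟨v, hv⟩
        have : (v ++ [c]) ++ w = u ++ w := by simpa using hv
        have := List.append_cancel_right this
        subst this
        simp
      · rintro rfl
        refine ⟨u.dropLast, ?_⟩
        conv_rhs => rw [← List.dropLast_append_getLast hu]
        simp
    simp [key]
  · refine Finset.sum_eq_zero fun c _ => if_neg fun hc => hw ((List.suffix_cons c w).trans hc)

/-- Each common word, the empty one included, is a proper suffix of `x` because `x` is not a prefix
of `y`; exactly one letter precedes it in `x`. The empty word gives the term 1. -/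
theorem sum_overlap_cons {R : Type*} [CommRing R] (t : R) {x y : List (Fin q)}
    (h : ¬ x <+: y) :
    ∑ c : Fin q, overlap t x (c :: y) = 1 + t * overlap t x y := by
  have h1 : ∀ c, overlap t x (c :: y) =
      ∑ k ∈ Finset.range (y.length + 1), if c :: y.take k <:+ x then t ^ k else 0 :=
    fun c => Finset.sum_congr rfl fun k _ => if_congr Iff.rfl rfl rfl
  simp only [h1]
  rw [Finset.sum_comm, Finset.sum_congr rfl fun k _ =>
    sum_cons_suffix (fun e : y.take k = x => h (e ▸ List.take_prefix k y)) _, Finset.sum_range_succ', overlap,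
    Finset.mul_sum, add_comm]
  congr 1
  · simp
  · refine Finset.sum_congr rfl fun k _ => ?_
    rw [mul_ite, mul_zero, pow_succ']

/-- The hypothesis rules out an occurrence of `y` that ends before `x` does, which the correlation
polynomial would count although it is not a suffix–prefix overlap. -/
theorem overlapAt_iff {x y : List (Fin q)} {k : ℕ} (hk : k < x.length)
    (h : ∀ l, l + y.length < x.length → ¬ y <+: x.drop l) :
    OverlapAt x y (x.length - 1 - k) ↔ k < y.length ∧ y.take (k + 1) <:+ x := by
  have hl : x.length - (x.length - 1 - k) = k + 1 := by omega
  have e : ∀ j, x[x.length - 1 - k + j]? = (x.drop (x.length - 1 - k))[j]? := fun j => by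
    rw [List.getElem?_drop]
  have hdl : (x.drop (x.length - 1 - k)).length = k + 1 := by rw [List.length_drop, hl]
  unfold OverlapAt
  rw [hl]
  simp only [e]
  constructor
  · intro ho
    have hky : k < y.length := by
      by_contra hky
      refine h (x.length - 1 - k) (by omega) ?_
      rw [List.prefix_iff_getElem?]
      intro j hj
      rw [ho j (by omega)]
      simp [hj]
    refine ⟨hky, ?_⟩
    have : y.take (k + 1) = x.drop (x.length - 1 - k) := by
      refine List.ext_getElem? fun j => ?_
      rcases lt_or_ge j (k + 1) with hj | hj
      · rw [List.getElem?_take_of_lt hj, ho j (by omega)]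
      · rw [List.getElem?_eq_none (by simp; omega), List.getElem?_eq_none (by omega)]
    rw [this]
    exact List.drop_suffix _ _
  · rintro ⟨hky, hs⟩ j hj
    have h2 := List.suffix_iff_eq_drop.1 hs
    rw [List.length_take, min_eq_left (by omega),
      show x.length - (k + 1) = x.length - 1 - k by omega] at h2
    rw [← h2, List.getElem?_take_of_lt (by omega)]

theorem aeval_corr {R : Type*} [CommRing R] (t : R) {x y : List (Fin q)}
    (h : ∀ l, l + y.length < x.length → ¬ y <+: x.drop l) :
    Polynomial.aeval t (corr x y) = overlap t x y := by
  rw [overlap_eq_sum t x y (N := x.length + y.length) (by omega), corr, map_sum,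
    ← Finset.sum_range_reflect]
  rw [← Finset.sum_subset (Finset.range_mono (Nat.le_add_right x.length y.length))]
  · refine Finset.sum_congr rfl fun k hk => ?_
    have hk := Finset.mem_range.1 hk
    simp only [overlapAt_iff hk h]
    rw [show x.length - 1 - (x.length - 1 - k) = k by omega]
    split_ifs <;> simp
  · intro k _ hk
    rw [if_neg]
    rintro ⟨h1, h2⟩
    refine hk (Finset.mem_range.2 ?_)
    have := h2.length_le
    rw [List.length_take, min_eq_left (by omega)] at this
    omega

end Overlap

/-! ### Word weights and the invertibility of the overlap matrix -/

section Core

variable {q s : ℕ} {a : Fin s → List (Fin q)}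

/-- The function `x ↦ κ - ∑ i, y i * (a i, x)_t` on words. -/
noncomputable def wordWeight (a : Fin s → List (Fin q)) (t : ℝ) (y : Fin s → ℝ) (κ : ℝ)
    (x : List (Fin q)) : ℝ :=
  κ - ∑ i, y i * overlap t (a i) x

variable {t κ : ℝ} {y : Fin s → ℝ}

theorem wordWeight_nil : wordWeight a t y κ [] = κ := by
  simp [wordWeight, overlap_nil]

theorem wordWeight_neg (x : List (Fin q)) :
    wordWeight a t (-y) (-κ) x = - wordWeight a t y κ x := by
  simp [wordWeight]; ring

theorem wordWeight_append_singleton (x : List (Fin q)) (c : Fin q) :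
    wordWeight a t y κ (x ++ [c]) =
      wordWeight a t y κ x - ∑ i, y i * if x ++ [c] <:+ a i then t ^ x.length else 0 := by
  simp only [wordWeight, overlap_append_singleton, mul_add, Finset.sum_add_distrib]
  ring

theorem sum_wordWeight_cons {x : List (Fin q)} (hx : Avoids a x) :
    ∑ c, wordWeight a t y κ (c :: x) =
      t * wordWeight a t y κ x + ((q - t) * κ - ∑ i, y i) := by
  simp only [wordWeight, Finset.sum_sub_distrib]
  rw [Finset.sum_comm]
  simp only [← Finset.mul_sum, sum_overlap_cons t fun h => hx _ h.isInfix, mul_add, mul_one,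
    Finset.sum_add_distrib]
  simp only [Finset.sum_const, Finset.card_univ, Fintype.card_fin, nsmul_eq_mul, mul_sub,
    Finset.mul_sum]
  have : ∑ i, y i * (t * overlap t (a i) x) = ∑ i, t * (y i * overlap t (a i) x) :=
    Finset.sum_congr rfl fun i _ => by ring
  rw [this]
  ring

/-- A new overlap with some `a i` would be a suffix of `a i` strictly longer than `a j` and
containing it, contrary to `hred`. -/
theorem wordWeight_append (hred : ∀ i j, a i <:+: a j → i = j) (j : Fin s) (u : List (Fin q)) :
    wordWeight a t y κ (a j ++ u) = wordWeight a t y κ (a j) := by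
  induction u using List.reverseRecOn with
  | nil => simp
  | append_singleton u c ih =>
    rw [← List.append_assoc, wordWeight_append_singleton, ih, Finset.sum_eq_zero, sub_zero]
    intro i _
    rw [if_neg, mul_zero]
    intro h
    have hij : j = i := hred j i (((List.prefix_append (a j) u).trans
      (List.prefix_append _ [c])).isInfix.trans h.isInfix)
    subst hij
    have := h.length_le
    simp at this

theorem wordWeight_of_not_avoids_cons (hred : ∀ i j, a i <:+: a j → i = j)
    (h0 : ∀ j, wordWeight a t y κ (a j) = 0) {x : List (Fin q)} (hx : Avoids a x) {c : Fin q}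
    (hc : ¬ Avoids a (c :: x)) : wordWeight a t y κ (c :: x) = 0 := by
  simp only [Avoids, not_forall, not_not] at hc
  obtain ⟨j, hj⟩ := hc
  obtain ⟨u, hu⟩ := (List.infix_cons_iff.1 hj).resolve_right (hx j)
  rw [← hu, wordWeight_append hred, h0]

open Classical in
theorem sum_avoids_wordWeight_cons (hred : ∀ i j, a i <:+: a j → i = j)
    (h0 : ∀ j, wordWeight a t y κ (a j) = 0) {x : List (Fin q)} (hx : Avoids a x) :
    (∑ c, if Avoids a (c :: x) then wordWeight a t y κ (c :: x) else 0) =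
      t * wordWeight a t y κ x + ((q - t) * κ - ∑ i, y i) := by
  rw [← sum_wordWeight_cons hx]
  refine Finset.sum_congr rfl fun c _ => ?_
  split_ifs with h
  · rfl
  · exact (wordWeight_of_not_avoids_cons hred h0 hx h).symm

/-- The last letter matters only if `w` itself is a suffix of some `a i`; by length `w` would then
equal `a i`. This lets weights of words of length p be read off on words of length p - 1. -/
theorem wordWeight_dropLast {w : List (Fin q)} (hw : Avoids a w)
    (hlen : ∀ i, (a i).length ≤ w.length) :
    wordWeight a t y κ w.dropLast = wordWeight a t y κ w := by
  rcases List.eq_nil_or_concat' w with rfl | ⟨w, c, rfl⟩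
  · rfl
  · rw [List.dropLast_concat, wordWeight_append_singleton, Finset.sum_eq_zero, sub_zero]
    intro i _
    rw [if_neg, mul_zero]
    intro h
    exact hw i (h.eq_of_length_le (hlen i) ▸ List.infix_rfl)

variable {N : ℕ}

/-- With δ = 0, `t` times the weight of `x` is a sum of weights of words one letter longer, so
nonnegativity descends from length `N`. -/
theorem wordWeight_nonneg (hred : ∀ i j, a i <:+: a j → i = j) (ht : 0 < t)
    (h0 : ∀ j, wordWeight a t y κ (a j) = 0) (hδ : (q - t) * κ - ∑ i, y i = 0)
    (hN : ∀ x : List (Fin q), x.length = N → Avoids a x → 0 ≤ wordWeight a t y κ x)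
    {n : ℕ} (hn : n ≤ N) :
    ∀ x : List (Fin q), x.length = n → Avoids a x → 0 ≤ wordWeight a t y κ x := by
  classical
  induction hn using Nat.decreasingInduction with
  | self => exact hN
  | of_succ n _ ih =>
    intro x hx hxa
    have h := sum_avoids_wordWeight_cons hred h0 hxa
    rw [hδ, add_zero] at h
    refine nonneg_of_mul_nonneg_right (h ▸ Finset.sum_nonneg fun c _ => ?_) ht
    split_ifs with hc
    · exact ih _ (by simp [hx]) hc
    · exact le_rfl

/-- The empty word has weight zero, and a vanishing sum of nonnegative weights makes each left
extension vanish in turn. -/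
theorem wordWeight_eq_zero (hred : ∀ i j, a i <:+: a j → i = j) (ht : 0 < t)
    (h0 : ∀ j, wordWeight a t y 0 (a j) = 0) (hδ : (q - t) * 0 - ∑ i, y i = 0)
    (hN : ∀ x : List (Fin q), x.length = N → Avoids a x → 0 ≤ wordWeight a t y 0 x) :
    ∀ x : List (Fin q), x.length ≤ N → Avoids a x → wordWeight a t y 0 x = 0 := by
  classical
  intro x
  induction x with
  | nil => exact fun _ _ => wordWeight_nil
  | cons c x ih =>
    intro hx hxa
    have hx' : Avoids a x := hxa.mono (List.suffix_cons c x).isInfix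
    have h := sum_avoids_wordWeight_cons hred h0 hx'
    rw [hδ, add_zero, ih (by simp at hx; omega) hx', mul_zero,
      Finset.sum_eq_zero_iff_of_nonneg] at h
    · simpa [hxa] using h c (Finset.mem_univ c)
    · intro d _
      split_ifs with hd
      · exact wordWeight_nonneg hred ht h0 hδ hN hx _ rfl hd
      · exact le_rfl

/-- The coefficients of a word weight with constant term zero vanish. -/
theorem coeff_eq_zero (hred : ∀ i j, a i <:+: a j → i = j) (hne : ∀ i, a i ≠ [])
    (hlen : ∀ i, (a i).length ≤ N + 1) (ht : 0 < t)
    (h0 : ∀ j, wordWeight a t y 0 (a j) = 0) (hδ : (q - t) * 0 - ∑ i, y i = 0)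
    (hN : ∀ x : List (Fin q), x.length = N → Avoids a x → 0 ≤ wordWeight a t y 0 x) :
    y = 0 := by
  funext i
  have e := List.dropLast_append_getLast (hne i)
  have hl : (a i).dropLast.length ≤ N := by
    rw [List.length_dropLast]; have := hlen i; omega
  have hav : Avoids a (a i).dropLast := fun j hj => by
    have := hred j i (hj.trans (List.dropLast_prefix _).isInfix)
    subst this
    have := hj.length_le
    have := List.length_pos_iff.2 (hne j)
    rw [List.length_dropLast] at *
    omega
  -- The last letter of `a i` changes the weight by exactly `-y i * t ^ (|a i| - 1)`, and the weight
  -- is zero both before and after.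
  have h1 := wordWeight_append_singleton (a := a) (t := t) (y := y) (κ := 0) (a i).dropLast
    ((a i).getLast (hne i))
  rw [e, h0, wordWeight_eq_zero hred ht h0 hδ hN _ hl hav, zero_sub, Finset.sum_eq_single i] at h1
  · rw [if_pos List.suffix_rfl, eq_comm, neg_eq_zero] at h1
    exact (mul_eq_zero.1 h1).resolve_right (pow_pos ht _).ne'
  · intro j _ hj
    rw [if_neg, mul_zero]
    exact fun h => hj (hred i j h.isInfix).symm
  · exact fun h => absurd (Finset.mem_univ i) h

open Classical in
/-- Perron–Frobenius property of the transfer operator on functions of the words of length `N`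
avoiding `a` which extends words to the left: real solutions `U` of `L U = t U + δ` have `δ = 0`
and constant sign. -/
def LeftPerron (a : Fin s → List (Fin q)) (N : ℕ) (t : ℝ) : Prop :=
  ∀ (U : List (Fin q) → ℝ) (δ : ℝ),
    (∀ x, x.length = N → Avoids a x →
      (∑ c, if Avoids a (c :: x) then U (c :: x).dropLast else 0) = t * U x + δ) →
    δ = 0 ∧ ((∀ x, x.length = N → Avoids a x → U x = 0) ∨
      (∀ x, x.length = N → Avoids a x → 0 < U x) ∨ (∀ x, x.length = N → Avoids a x → U x < 0))

open Classical in
theorem sum_wordWeight_dropLast (hred : ∀ i j, a i <:+: a j → i = j)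
    (hlen : ∀ i, (a i).length ≤ N + 1)
    (h0 : ∀ j, wordWeight a t y κ (a j) = 0)
    (x : List (Fin q)) (hxl : x.length = N) (hx : Avoids a x) :
    (∑ c, if Avoids a (c :: x) then wordWeight a t y κ (c :: x).dropLast else 0) =
      t * wordWeight a t y κ x + ((q - t) * κ - ∑ i, y i) := by
  rw [← sum_avoids_wordWeight_cons hred h0 hx]
  refine Finset.sum_congr rfl fun c _ => ?_
  split_ifs with h
  · exact wordWeight_dropLast h fun i => by simpa [hxl] using hlen i
  · rfl

theorem LeftPerron.coeff_eq_zero (hP : LeftPerron a N t) (hred : ∀ i j, a i <:+: a j → i = j)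
    (hne : ∀ i, a i ≠ []) (hlen : ∀ i, (a i).length ≤ N + 1) (ht : 0 < t)
    (h0 : ∀ j, wordWeight a t y 0 (a j) = 0) : y = 0 := by
  obtain ⟨hδ, h⟩ := hP _ _ (sum_wordWeight_dropLast hred hlen h0)
  rcases h with h | h | h
  · exact SFT.coeff_eq_zero hred hne hlen ht h0 hδ fun x hx hxa => (h x hx hxa).ge
  · exact SFT.coeff_eq_zero hred hne hlen ht h0 hδ fun x hx hxa => (h x hx hxa).le
  · have hneg : ∀ x, wordWeight a t (-y) 0 x = - wordWeight a t y 0 x := fun x => by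
      rw [← wordWeight_neg, neg_zero]
    refine neg_eq_zero.1 (SFT.coeff_eq_zero (N := N) hred hne hlen ht (fun j => ?_) ?_
      fun x hx hxa => ?_)
    · rw [hneg, h0, neg_zero]
    · simpa using hδ
    · rw [hneg]
      exact neg_nonneg.2 (h x hx hxa).le

open Classical in
theorem LeftPerron.eigen (hP : LeftPerron a N t) (hred : ∀ i j, a i <:+: a j → i = j)
    (hne : ∀ i, a i ≠ []) (hlen : ∀ i, (a i).length ≤ N + 1) (ht : 0 < t)
    (h0 : ∀ j, wordWeight a t y 1 (a j) = 0) :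
    (∃ x, x.length = N ∧ Avoids a x ∧ wordWeight a t y 1 x ≠ 0) ∧
    ∀ x, x.length = N → Avoids a x →
      (∑ c, if Avoids a (c :: x) then wordWeight a t y 1 (c :: x).dropLast else 0) =
        t * wordWeight a t y 1 x := by
  have hδ := (hP _ _ (sum_wordWeight_dropLast hred hlen h0)).1
  refine ⟨?_, fun x hx hxa => by rw [sum_wordWeight_dropLast hred hlen h0 x hx hxa, hδ, add_zero]⟩
  by_contra! hz
  have hnil : Avoids a [] := fun i hi => hne i (List.infix_nil.1 hi)
  -- If the weight vanished at length `N`, its negative would be nonnegative down to the empty word,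
  -- where it is -1.
  have h1 := wordWeight_nonneg (y := -y) (κ := -1) (N := N) hred ht
    (fun j => by rw [wordWeight_neg, h0, neg_zero])
    (by simp only [Pi.neg_apply, Finset.sum_neg_distrib]; linarith)
    (fun x hx hxa => by rw [wordWeight_neg, hz x hx hxa, neg_zero]) (Nat.zero_le N) [] rfl hnil
  rw [wordWeight_nil] at h1
  linarith

/-- The matrix of the overlaps `(a j, a i)_t`. -/
def overlapMatrix (a : Fin s → List (Fin q)) (t : ℝ) : Matrix (Fin s) (Fin s) ℝ :=
  Matrix.of fun i j => overlap t (a j) (a i)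

theorem overlapMatrix_mulVec (y : Fin s → ℝ) (j : Fin s) :
    (overlapMatrix a t).mulVec y j = ∑ i, y i * overlap t (a i) (a j) := by
  simp [Matrix.mulVec, dotProduct, overlapMatrix, mul_comm]

theorem LeftPerron.det_ne_zero (hP : LeftPerron a N t) (hred : ∀ i j, a i <:+: a j → i = j)
    (hne : ∀ i, a i ≠ []) (hlen : ∀ i, (a i).length ≤ N + 1) (ht : 0 < t) :
    (overlapMatrix a t).det ≠ 0 := by
  intro h
  obtain ⟨y, hy, hy0⟩ := Matrix.exists_mulVec_eq_zero_iff.2 h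
  refine hy (hP.coeff_eq_zero hred hne hlen ht fun j => ?_)
  rw [wordWeight, ← overlapMatrix_mulVec, hy0]
  simp

end Core

end SFT

namespace SFT

/-! ### Reversal of words, exchanging left and right -/

section Reverse

variable {q s : ℕ} {a : Fin s → List (Fin q)}

/-- The collection of the reversed words. -/
def reverseWords (a : Fin s → List (Fin q)) (i : Fin s) : List (Fin q) :=
  (a i).reverse

theorem avoids_reverseWords {w : List (Fin q)} :
    Avoids (reverseWords a) w ↔ Avoids a w.reverse := by
  refine forall_congr' fun i => not_congr ?_
  rw [reverseWords, ← List.reverse_infix, List.reverse_reverse]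

theorem overlapMatrix_reverseWords (t : ℝ) :
    overlapMatrix (reverseWords a) t = (overlapMatrix a t).transpose := by
  ext i j
  exact overlap_reverse t (a i) (a j)

theorem reverseWords_reduced (hred : ∀ i j, a i <:+: a j → i = j) (i j : Fin s)
    (h : reverseWords a i <:+: reverseWords a j) : i = j :=
  hred i j (List.reverse_infix.1 h)

end Reverse

/-! ### From the adjacency matrix to extensions of words -/

section Transfer

variable {q s : ℕ} {a : Fin s → List (Fin q)}

-- Predecessors of `y` in the graph correspond to letters `c` with `c :: y` allowed, the predecessor
-- being `c :: y` without its last letter.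
open Classical in
theorem sum_mul_adjMatrix (hall : ∀ w, Allowed a w ↔ Avoids a w) (hp : 2 ≤ maxLength a)
    (f : List (Fin q) → ℝ) (y : AllowedWord a) :
    ∑ x : AllowedWord a, f x.1 * adjMatrix a x y =
      ∑ c, if Avoids a (c :: y.1) then f (c :: y.1).dropLast else 0 := by
  simp only [adjMatrix, Matrix.of_apply, mul_ite, mul_one, mul_zero]
  rw [← Finset.sum_filter, ← Finset.sum_filter]
  have hy0 : y.1 ≠ [] := List.length_pos_iff.1 (by have := y.2.1; omega)
  have key : ∀ (c b : Fin q) (u : List (Fin q)), y.1 = u ++ [b] →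
      (c :: y.1).dropLast = c :: u := fun c b u h => by
    rw [h, ← List.cons_append, List.dropLast_concat]
  symm
  refine Finset.sum_bij (fun c hc => ⟨(c :: y.1).dropLast, ?_, ?_⟩) ?_ ?_ ?_ ?_
  · simpa using y.2.1
  · rw [hall]
    exact (Finset.mem_filter.1 hc).2.mono (List.dropLast_prefix _).isInfix
  · intro c hc
    have e := List.dropLast_append_getLast hy0
    refine Finset.mem_filter.2 ⟨Finset.mem_univ _, y.1.getLast hy0, ?_, ?_⟩
    · simp only [key c _ _ e.symm, List.tail_cons, e]
    · simp only [hall, key c _ _ e.symm, List.cons_append, e]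
      exact (Finset.mem_filter.1 hc).2
  · intro c _ c' _ h
    have e := List.dropLast_append_getLast hy0
    have h := congrArg Subtype.val h
    simp only [key _ _ _ e.symm, List.cons.injEq] at h
    exact h.1
  · intro x hx
    obtain ⟨b, hb, hxb⟩ := (Finset.mem_filter.1 hx).2
    have hx0 : x.1 ≠ [] := List.length_pos_iff.1 (by have := x.2.1; omega)
    have e := List.cons_head_tail hx0
    refine ⟨x.1.head hx0, Finset.mem_filter.2 ⟨Finset.mem_univ _, ?_⟩, Subtype.ext ?_⟩
    · rw [hb, ← List.cons_append, e, ← hall]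
      exact hxb
    · simp only [key _ _ _ hb, e]
  · intro c _
    rfl

open Classical in
theorem sum_adjMatrix_mul (hall : ∀ w, Allowed a w ↔ Avoids a w) (hp : 2 ≤ maxLength a)
    (f : List (Fin q) → ℝ) (x : AllowedWord a) :
    ∑ y : AllowedWord a, adjMatrix a x y * f y.1 =
      ∑ c, if Avoids a (x.1 ++ [c]) then f (x.1 ++ [c]).tail else 0 := by
  simp only [adjMatrix, Matrix.of_apply, ite_mul, one_mul, zero_mul]
  rw [← Finset.sum_filter, ← Finset.sum_filter]
  have hx0 : x.1 ≠ [] := List.length_pos_iff.1 (by have := x.2.1; omega)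
  have key : ∀ c : Fin q, (x.1 ++ [c]).tail = x.1.tail ++ [c] := fun c =>
    List.tail_append_of_ne_nil hx0
  symm
  refine Finset.sum_bij (fun c hc => ⟨(x.1 ++ [c]).tail, ?_, ?_⟩) ?_ ?_ ?_ ?_
  · simpa using x.2.1
  · rw [hall]
    exact (Finset.mem_filter.1 hc).2.mono (List.tail_suffix _).isInfix
  · intro c hc
    exact Finset.mem_filter.2 ⟨Finset.mem_univ _, c, key c, (hall _).2 (Finset.mem_filter.1 hc).2⟩
  · intro c _ c' _ h
    have h := congrArg Subtype.val h
    simpa [key] using h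
  · intro y hy
    obtain ⟨b, hb, hxb⟩ := (Finset.mem_filter.1 hy).2
    exact ⟨b, Finset.mem_filter.2 ⟨Finset.mem_univ _, (hall _).1 hxb⟩,
      Subtype.ext ((key b).trans hb.symm)⟩
  · intro c _
    rfl

theorem leftPerron (hall : ∀ w, Allowed a w ↔ Avoids a w) (hp : 2 ≤ maxLength a)
    [Nonempty (AllowedWord a)] (hirr : (adjMatrix a).IsIrreducible) :
    LeftPerron a (maxLength a - 1) (perronRoot a) := by
  intro U δ h
  have h1 := hirr.transpose.eigenvector_sign (x := fun x => U x.1) (δ := δ) fun x => by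
    rw [Matrix.transpose_map, Matrix.spectralRadius_transpose, Matrix.mulVec_transpose]
    exact (sum_mul_adjMatrix hall hp U x).trans (h x.1 x.2.1 ((hall _).1 x.2.2))
  refine ⟨h1.1, h1.2.imp ?_ (Or.imp ?_ ?_)⟩ <;>
    exact fun h2 x hx hxa => h2 ⟨x, hx, (hall _).2 hxa⟩

theorem leftPerron_reverseWords (hall : ∀ w, Allowed a w ↔ Avoids a w) (hp : 2 ≤ maxLength a)
    [Nonempty (AllowedWord a)] (hirr : (adjMatrix a).IsIrreducible) :
    LeftPerron (reverseWords a) (maxLength a - 1) (perronRoot a) := by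
  classical
  intro U δ h
  have h1 := hirr.eigenvector_sign (x := fun x => U x.1.reverse) (δ := δ) fun x => by
    have hx : Avoids (reverseWords a) x.1.reverse := by
      rw [avoids_reverseWords, List.reverse_reverse]
      exact (hall _).1 x.2.2
    refine (sum_adjMatrix_mul hall hp (fun w => U w.reverse) x).trans ?_
    rw [← perronRoot, ← h x.1.reverse (by simpa using x.2.1) hx]
    refine Finset.sum_congr rfl fun c _ => if_congr ?_ ?_ rfl
    · simp [avoids_reverseWords]
    · simp [← List.dropLast_reverse]
  refine ⟨h1.1, h1.2.imp ?_ (Or.imp ?_ ?_)⟩ <;>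
  · intro h2 x hx hxa
    simpa using h2 ⟨x.reverse, by simpa using hx, (hall _).2 (avoids_reverseWords.1 hxa)⟩

end Transfer

/-! ### Limits of the row and column sums -/

section Limit

variable {q s : ℕ} {a : Fin s → List (Fin q)}

theorem continuous_corrMatrix : Continuous (corrMatrix a) :=
  continuous_matrix fun i j => (corr (a j) (a i)).continuous_aeval

theorem continuousAt_corrMatrix_inv {z : ℂ} (h : (corrMatrix a z).det ≠ 0) :
    ContinuousAt (fun w => (corrMatrix a w)⁻¹) z := by
  simp only [Matrix.inv_def, Ring.inverse_eq_inv']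
  exact (continuous_corrMatrix.matrix_det.continuousAt.inv₀ h).smul
    continuous_corrMatrix.matrix_adjugate.continuousAt

theorem corrMatrix_ofReal (hred : ∀ i j, a i <:+: a j → i = j) (t : ℝ) :
    corrMatrix a t = (overlapMatrix a t).map (algebraMap ℝ ℂ) := by
  ext i j
  simp only [corrMatrix, overlapMatrix, Matrix.of_apply, Matrix.map_apply]
  rw [← aeval_corr t, ← Complex.coe_algebraMap, Polynomial.aeval_algebraMap_apply]
  intro l hl h
  have hij : i = j := hred i j (h.isInfix.trans (List.drop_suffix _ _).isInfix)
  subst hij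
  omega

theorem corrMatrix_ofReal_inv (hred : ∀ i j, a i <:+: a j → i = j) {t : ℝ}
    (h : (overlapMatrix a t).det ≠ 0) :
    (corrMatrix a t)⁻¹ = (overlapMatrix a t)⁻¹.map (algebraMap ℝ ℂ) := by
  refine Matrix.inv_eq_right_inv ?_
  rw [corrMatrix_ofReal hred, ← Matrix.map_mul, Matrix.mul_nonsing_inv _ h.isUnit]
  simp

theorem corrMatrix_det_ne_zero (hred : ∀ i j, a i <:+: a j → i = j) {t : ℝ}
    (h : (overlapMatrix a t).det ≠ 0) : (corrMatrix a t).det ≠ 0 := by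
  rw [corrMatrix_ofReal hred, ← RingHom.mapMatrix_apply, ← RingHom.map_det]
  simpa using h

open Filter in
theorem tendsto_rowSum (hred : ∀ i j, a i <:+: a j → i = j) {t : ℝ}
    (h : (overlapMatrix a t).det ≠ 0) (i : Fin s) :
    Tendsto (rowSum a i) (𝓝[≠] (t : ℂ)) (𝓝 (((overlapMatrix a t)⁻¹.mulVec 1 i : ℝ) : ℂ)) := by
  have hc := continuousAt_corrMatrix_inv (corrMatrix_det_ne_zero hred h)
  have : ContinuousAt (rowSum a i) (t : ℂ) :=
    tendsto_finsetSum _ fun j _ => ((continuous_apply_apply i j).continuousAt.comp hc)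
  convert this.tendsto.mono_left nhdsWithin_le_nhds using 2
  simp [rowSum, corrMatrix_ofReal_inv hred h, Matrix.mulVec, dotProduct]

open Filter in
theorem tendsto_colSum (hred : ∀ i j, a i <:+: a j → i = j) {t : ℝ}
    (h : (overlapMatrix a t).det ≠ 0) (j : Fin s) :
    Tendsto (colSum a j) (𝓝[≠] (t : ℂ)) (𝓝 (((overlapMatrix a t)⁻¹.vecMul 1 j : ℝ) : ℂ)) := by
  have hc := continuousAt_corrMatrix_inv (corrMatrix_det_ne_zero hred h)
  have : ContinuousAt (colSum a j) (t : ℂ) :=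
    tendsto_finsetSum _ fun i _ => ((continuous_apply_apply i j).continuousAt.comp hc)
  convert this.tendsto.mono_left nhdsWithin_le_nhds using 2
  simp [colSum, corrMatrix_ofReal_inv hred h, Matrix.vecMul, dotProduct]

end Limit

/-! ### The vectors `u` and `v` as word weights -/

section Eigenvectors

variable {q s : ℕ} {a : Fin s → List (Fin q)}

/-- Removing the first symbol loses only the overlap by all of `w`. In `leftVec` the removal keeps
the first word no longer than `x`, so that `aeval_corr` applies. -/
theorem overlap_tail {R : Type*} [CommRing R] (t : R) {x w : List (Fin q)} (h : ¬ w <+: x) :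
    overlap t w.tail x = overlap t w x := by
  refine Finset.sum_congr rfl fun k _ => if_congr ?_ rfl rfl
  refine ⟨fun hs => hs.trans (List.tail_suffix w), fun hs => ?_⟩
  cases w with
  | nil => exact absurd List.nil_prefix h
  | cons c w =>
    rw [List.tail_cons]
    exact (List.suffix_cons_iff.1 hs).resolve_left fun e => h (e ▸ List.take_prefix _ _)

theorem leftVec_eq (hlen : ∀ i, (a i).length ≤ maxLength a) (R : Fin s → ℝ) (x : AllowedWord a) :
    leftVec a R x = wordWeight a (perronRoot a) R 1 x.1 := by
  simp only [leftVec, wordWeight]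
  congr 1
  refine Finset.sum_congr rfl fun i _ => ?_
  rw [aeval_corr, overlap_tail]
  · exact fun h => x.2.2.avoids i h.isInfix
  · intro l hl
    have := hlen i
    have := x.2.1
    rw [List.length_tail] at hl
    omega

theorem rightVec_eq (C : Fin s → ℝ) (x : AllowedWord a) :
    rightVec a C x = wordWeight (reverseWords a) (perronRoot a) C 1 x.1.reverse := by
  simp only [rightVec, wordWeight]
  congr 1
  refine Finset.sum_congr rfl fun i _ => ?_
  rw [aeval_corr, reverseWords, overlap_reverse]
  exact fun l _ h => x.2.2.avoids i (h.isInfix.trans (List.drop_suffix _ _).isInfix)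

theorem length_le_maxLength (i : Fin s) : (a i).length ≤ maxLength a :=
  Finset.le_sup (f := fun i => (a i).length) (Finset.mem_univ i)

theorem IsMinimal.nonempty_allowedWord (hmin : IsMinimal a) (hq : 0 < q) (hne : ∀ i, a i ≠ []) :
    Nonempty (AllowedWord a) := by
  have h : ∀ n, ∃ w : List (Fin q), w.length = n ∧ Avoids a w := fun n => by
    induction n with
    | zero => exact ⟨[], rfl, fun i hi => hne i (List.infix_nil.1 hi)⟩
    | succ n ih =>
      obtain ⟨w, hw, hwa⟩ := ih
      obtain ⟨c, hc⟩ := hmin.exists_avoids_append hq hne hwa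
      exact ⟨w ++ [c], by simp [hw], hc⟩
  obtain ⟨w, hw, hwa⟩ := h (maxLength a - 1)
  exact ⟨⟨w, hw, hmin.allowed_of_avoids hq hne hwa⟩⟩

theorem wordWeight_inv_mulVec {b : Fin s → List (Fin q)} {t : ℝ}
    (h : (overlapMatrix b t).det ≠ 0) (j : Fin s) :
    wordWeight b t ((overlapMatrix b t)⁻¹.mulVec 1) 1 (b j) = 0 := by
  rw [wordWeight, ← overlapMatrix_mulVec, Matrix.mulVec_mulVec,
    Matrix.mul_nonsing_inv _ h.isUnit, Matrix.one_mulVec]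
  simp

end Eigenvectors

end SFT

open SFT Filter in
theorem theorem6p3 (q s : ℕ) (hq : 2 ≤ q) (hs : 0 < s)
    (a : Fin s → List (Fin q)) (ha : Function.Injective a) (hlen : ∀ i, 2 ≤ (a i).length)
    (hmin : IsMinimal a) (hirr : (adjMatrix a).IsIrreducible) :
    ∃ R C : Fin s → ℝ,
      (∀ i, Tendsto (rowSum a i) (𝓝[≠] (perronRoot a : ℂ)) (𝓝 (R i : ℂ))) ∧
      (∀ j, Tendsto (colSum a j) (𝓝[≠] (perronRoot a : ℂ)) (𝓝 (C j : ℂ))) ∧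
      (rightVec a C ≠ 0 ∧
        Matrix.mulVec (adjMatrix a) (rightVec a C) = perronRoot a • rightVec a C) ∧
      (leftVec a R ≠ 0 ∧
        Matrix.vecMul (leftVec a R) (adjMatrix a) = perronRoot a • leftVec a R) := by
  classical
  have hq0 : 0 < q := by omega
  have hne : ∀ i, a i ≠ [] := fun i => List.length_pos_iff.1 (by have := hlen i; omega)
  have hred : ∀ i j, a i <:+: a j → i = j := fun i j => hmin.eq_of_infix ha
  have hall : ∀ w, Allowed a w ↔ Avoids a w := fun w => hmin.allowed_iff hq0 hne
  have hp : 2 ≤ maxLength a := (hlen ⟨0, hs⟩).trans (length_le_maxLength _)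
  have hlN : ∀ i, (a i).length ≤ maxLength a - 1 + 1 := fun i => by
    have := length_le_maxLength (a := a) i; omega
  have : Nonempty (AllowedWord a) := hmin.nonempty_allowedWord hq0 hne
  have ht : 0 < perronRoot a := hirr.spectralRadius_pos
  have hL := leftPerron hall hp hirr
  have hR := leftPerron_reverseWords hall hp hirr
  have hdet := hL.det_ne_zero hred hne hlN ht
  have hredr := reverseWords_reduced hred
  have hner : ∀ i, reverseWords a i ≠ [] := fun i => by simpa [reverseWords] using hne i
  have hlNr : ∀ i, (reverseWords a i).length ≤ maxLength a - 1 + 1 := fun i => by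
    simpa [reverseWords] using hlN i
  have hdetr := hR.det_ne_zero hredr hner hlNr ht
  set M := overlapMatrix a (perronRoot a) with hM
  obtain ⟨⟨x, hx, hxa, hx0⟩, hLe⟩ :=
    hL.eigen hred hne hlN ht (wordWeight_inv_mulVec hdet)
  obtain ⟨⟨w, hw, hwa, hw0⟩, hRe⟩ :=
    hR.eigen hredr hner hlNr ht (wordWeight_inv_mulVec hdetr)
  -- Reversal transposes the matrix, so the row sums of the inverse for the reversed words are the
  -- column sums of `M⁻¹`.
  have hC : (overlapMatrix (reverseWords a) (perronRoot a))⁻¹.mulVec 1 = M⁻¹.vecMul 1 := by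
    rw [overlapMatrix_reverseWords, ← Matrix.transpose_nonsing_inv, Matrix.mulVec_transpose]
  rw [hC] at hw0 hRe
  refine ⟨M⁻¹.mulVec 1, M⁻¹.vecMul 1, tendsto_rowSum hred hdet, tendsto_colSum hred hdet,
    ⟨?_, ?_⟩, ?_, ?_⟩
  · intro h
    have h1 := congrFun h ⟨w.reverse, by simpa using hw, (hall _).2 (avoids_reverseWords.1 hwa)⟩
    rw [rightVec_eq] at h1
    simp only [List.reverse_reverse, Pi.zero_apply] at h1
    exact hw0 h1
  · funext y
    rw [funext fun x => rightVec_eq (M⁻¹.vecMul 1) x, Pi.smul_apply, smul_eq_mul]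
    have hy : Avoids (reverseWords a) y.1.reverse := by
      rw [avoids_reverseWords, List.reverse_reverse]
      exact y.2.2.avoids
    refine (sum_adjMatrix_mul hall hp
      (fun u => wordWeight (reverseWords a) (perronRoot a) (M⁻¹.vecMul 1) 1 u.reverse) y).trans ?_
    rw [← hRe _ (by simpa using y.2.1) hy]
    refine Finset.sum_congr rfl fun c _ => if_congr ?_ ?_ rfl
    · simp [avoids_reverseWords]
    · simp [← List.dropLast_reverse]
  · intro h
    have h1 := congrFun h ⟨x, hx, (hall _).2 hxa⟩
    rw [leftVec_eq length_le_maxLength] at h1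
    exact hx0 h1
  · funext y
    rw [funext fun x => leftVec_eq length_le_maxLength (M⁻¹.mulVec 1) x, Pi.smul_apply,
      smul_eq_mul]
    exact (sum_mul_adjMatrix hall hp
      (wordWeight a (perronRoot a) (M⁻¹.mulVec 1) 1) y).trans (hLe y.1 y.2.1 y.2.2.avoids)
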